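/- Let $k$ be a finite field with $q$ elements, put $v=\sqrt q\in\mathbb R$, and let $\mathbb Q(v)\subseteq\mathbb R$ be the field generated by $v$. Let $\mathcal C$ be a $k$-linear triangulated category with shift functor $[1]$ such that (1) $\operatorname{Hom}(X,Y)$ is a finite-dimensional $k$-vector space for all objects $X,Y$; (2) the endomorphism ring of every indecomposable object is local; (3) there is an isomorphism of functors $[1]^t\cong 1_{\mathcal C}$ for some odd integer $t>1$, which we fix. For objects $X,Y,L$ of $\mathcal C$, let $(X,L)_Y$ be the set of morphisms $X\to L$ whose mapping cone is isomorphic to $Y$, and put $$F_{XY}^L=\frac{|(X,L)_Y|}{|\operatorname{Aut}X|}\cdot\Big(\prod_{i=1}^t\frac{|\operatorname{Hom}(X[i],L)|^{(-1)^i}}{|\operatorname{Hom}(X[i],X)|^{(-1)^i}}\Big)^{1/2}$$ (nonnegative square root). This number lies in $\mathbb Q(v)$ and depends only on the isomorphism classes $[X],[Y],[L]$. Let $\mathcal H(\mathcal C)$ be the $\mathbb Q(v)$-vector space with basis $\{u_{[X]}\}$ indexed by the isomorphism classes of objects of $\mathcal C$. Then for all $X,Y$ only finitely many classes $[L]$ satisfy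 $F_{XY}^L\neq 0$, and with the $\mathbb Q(v)$-bilinear multiplication determined by $$u_{[X]}*u_{[Y]}=\sum_{[L]}F_{XY}^L\,u_{[L]},$$ $\mathcal H(\mathcal C)$ is an associative algebra with unit $u_{[0]}$. -/

import Mathlib

open CategoryTheory CategoryTheory.Limits CategoryTheory.Pretriangulated
open scoped ZeroObject IntermediateField

universe w u z

noncomputable section

namespace PeriodicHall

/-- The number `v = √q`, where `q` is the number of elements of the finite field `k`. -/
def v (k : Type*) : ℝ := Real.sqrt (Nat.card k)

/-- The coefficient field `ℚ(v) = ℚ(√q)`, as a subfield of `ℝ`. -/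
abbrev CoeffField (k : Type*) : IntermediateField ℚ ℝ := ℚ⟮v k⟯

section StructureConstants

variable {C : Type u} [Category.{w} C] [HasZeroObject C] [HasShift C ℤ] [Preadditive C]
  [∀ n : ℤ, (shiftFunctor C n).Additive] [Pretriangulated C]

/-- `(X, L)_Y`: the set of morphisms `f : X ⟶ L` whose mapping cone is isomorphic to `Y`, i.e.
which fit into a distinguished triangle `X ⟶ L ⟶ Z ⟶ X⟦1⟧` with `Z ≅ Y`. -/
def homsWithCone (X L Y : C) : Set (X ⟶ L) :=
  {f | ∃ (Z : C) (g : L ⟶ Z) (h : Z ⟶ X⟦(1 : ℤ)⟧),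
    Triangle.mk f g h ∈ (distTriang C) ∧ Nonempty (Z ≅ Y)}

/-- The number
`F_{XY}^L = |(X,L)_Y| / |Aut X| *
  (∏_{i=1}^t |Hom(X[i],L)|^{(-1)^i} / |Hom(X[i],X)|^{(-1)^i})^{1/2}`. -/
def toenConst (t : ℕ) (X Y L : C) : ℝ :=
  (Nat.card (homsWithCone X L Y) : ℝ) / (Nat.card (Aut X) : ℝ) *
    Real.sqrt (∏ i ∈ Finset.Icc 1 t,
      (Nat.card (X⟦(i : ℤ)⟧ ⟶ L) : ℝ) ^ ((-1 : ℤ) ^ i) /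
        (Nat.card (X⟦(i : ℤ)⟧ ⟶ X) : ℝ) ^ ((-1 : ℤ) ^ i))

lemma homsWithCone_comp {X X' L L' Y Y' : C} (a : X ≅ X') (b : L ≅ L') (c : Y ≅ Y')
    {f : X ⟶ L} (hf : f ∈ homsWithCone X L Y) :
    a.inv ≫ f ≫ b.hom ∈ homsWithCone X' L' Y' := by
  obtain ⟨Z, g, h, hT, ⟨e⟩⟩ := hf
  have h1 : (a.inv ≫ f ≫ b.hom) ≫ b.inv = a.inv ≫ f := by simp
  have h2 : (b.inv ≫ g) ≫ 𝟙 Z = b.inv ≫ g := by simp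
  have h3 : (h ≫ a.hom⟦(1 : ℤ)⟧') ≫ a.inv⟦(1 : ℤ)⟧' = 𝟙 Z ≫ h := by
    rw [Category.assoc, ← Functor.map_comp]
    simp
  exact ⟨Z, b.inv ≫ g, h ≫ a.hom⟦(1 : ℤ)⟧',
    isomorphic_distinguished _ hT _ (Triangle.isoMk _ _ a.symm b.symm (Iso.refl _) h1 h2 h3),
    ⟨e ≪≫ c⟩⟩

lemma card_homsWithCone_congr {X X' L L' Y Y' : C} (a : X ≅ X') (b : L ≅ L') (c : Y ≅ Y') :
    Nat.card (homsWithCone X L Y) = Nat.card (homsWithCone X' L' Y') := by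
  refine Nat.card_congr ⟨fun f => ⟨_, homsWithCone_comp a b c f.2⟩,
    fun f => ⟨_, homsWithCone_comp a.symm b.symm c.symm f.2⟩, ?_, ?_⟩
  · rintro ⟨f, hf⟩; simp
  · rintro ⟨f, hf⟩; simp

/-- The structure constant depends only on the isomorphism classes of the three objects. -/
lemma toenConst_congr (t : ℕ) {X X' Y Y' L L' : C} (a : X ≅ X') (c : Y ≅ Y') (b : L ≅ L') :
    toenConst t X Y L = toenConst t X' Y' L' := by
  have hL : ∀ i : ℤ, Nat.card (X⟦i⟧ ⟶ L) = Nat.card (X'⟦i⟧ ⟶ L') := fun i =>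
    Nat.card_congr (((shiftFunctor C i).mapIso a).homCongr b)
  have hX : ∀ i : ℤ, Nat.card (X⟦i⟧ ⟶ X) = Nat.card (X'⟦i⟧ ⟶ X') := fun i =>
    Nat.card_congr (((shiftFunctor C i).mapIso a).homCongr a)
  have hA : Nat.card (Aut X) = Nat.card (Aut X') := Nat.card_congr a.conjAut.toEquiv
  simp only [toenConst, card_homsWithCone_congr a b c, hL, hX, hA]

end StructureConstants

/-- A vector space over a finite field with `q` elements is infinite (and then `Nat.card` is `0`),
or has `q ^ n` elements. -/
lemma natCard_eq_zero_or_pow (k V : Type*) [Field k] [Finite k] [AddCommGroup V] [Module k V] :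
    (Nat.card V : ℝ) = 0 ∨ ∃ n : ℤ, (Nat.card V : ℝ) = (Nat.card k : ℝ) ^ n := by
  rcases finite_or_infinite V with hV | hV
  · refine Or.inr ⟨Module.finrank k V, ?_⟩
    rw [Module.natCard_eq_pow_finrank (K := k)]
    simp
  · exact Or.inl (by simp)

lemma sqrt_card_zpow (k : Type*) (n : ℤ) : Real.sqrt ((Nat.card k : ℝ) ^ n) = v k ^ n := by
  have h : (Nat.card k : ℝ) = v k ^ 2 := (Real.sq_sqrt (Nat.cast_nonneg _)).symm
  have h0 : 0 ≤ v k := Real.sqrt_nonneg _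
  have h2 : (Nat.card k : ℝ) ^ n = (v k ^ n) ^ 2 := by
    rw [h, ← zpow_natCast, ← zpow_mul, ← zpow_natCast, ← zpow_mul, mul_comm]
  rw [h2, Real.sqrt_sq (zpow_nonneg h0 n)]

section HallSpace

variable (k : Type*) [Field k] [Finite k] (t : ℕ)
variable (C : Type u) [Category.{w} C] [HasZeroObject C] [HasShift C ℤ] [Preadditive C]
  [Linear k C] [∀ n : ℤ, (shiftFunctor C n).Additive] [Pretriangulated C]

variable {C} in
/-- The structure constants lie in `ℚ(v)`. -/
lemma toenConst_mem (X Y L : C) : toenConst t X Y L ∈ CoeffField k := by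
  have hq : (Nat.card k : ℝ) ≠ 0 := Nat.cast_ne_zero.2 Nat.card_pos.ne'
  let P : ℝ → Prop := fun x => x = 0 ∨ ∃ n : ℤ, x = (Nat.card k : ℝ) ^ n
  have hmul : ∀ x y, P x → P y → P (x * y) := by
    rintro x y (rfl | ⟨n, rfl⟩) (rfl | ⟨m, rfl⟩)
    · exact Or.inl (by simp)
    · exact Or.inl (by simp)
    · exact Or.inl (by simp)
    · exact Or.inr ⟨n + m, (zpow_add₀ hq n m).symm⟩
  have hinv : ∀ x, P x → P x⁻¹ := by
    rintro x (rfl | ⟨n, rfl⟩)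
    · exact Or.inl (by simp)
    · exact Or.inr ⟨-n, (zpow_neg _ n).symm⟩
  have hsign : ∀ (i : ℕ) x, P x → P (x ^ ((-1 : ℤ) ^ i)) := by
    intro i x hx
    rcases neg_one_pow_eq_or ℤ i with h | h
    · simpa only [h, zpow_one] using hx
    · simpa only [h, zpow_neg, zpow_one] using hinv x hx
  have hP : P (∏ i ∈ Finset.Icc 1 t,
      (Nat.card (X⟦(i : ℤ)⟧ ⟶ L) : ℝ) ^ ((-1 : ℤ) ^ i) /
        (Nat.card (X⟦(i : ℤ)⟧ ⟶ X) : ℝ) ^ ((-1 : ℤ) ^ i)) := by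
    refine Finset.prod_induction _ P hmul (Or.inr ⟨0, by simp⟩) fun i _ => ?_
    rw [div_eq_mul_inv]
    exact hmul _ _ (hsign i _ (natCard_eq_zero_or_pow k _))
      (hinv _ (hsign i _ (natCard_eq_zero_or_pow k _)))
  refine mul_mem (div_mem (natCast_mem _ _) (natCast_mem _ _)) ?_
  rcases hP with h | ⟨n, h⟩
  · rw [h, Real.sqrt_zero]; exact zero_mem _
  · rw [h, sqrt_card_zpow]
    exact zpow_mem (IntermediateField.mem_adjoin_simple_self ℚ (v k)) n

/-- The set of isomorphism classes of objects of `C`. -/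
abbrev IsoClasses (C : Type u) [Category.{w} C] : Type u := Quotient (isIsomorphicSetoid C)

variable {C} in
/-- The isomorphism class `[X]`. -/
abbrev isoClass (X : C) : IsoClasses C := Quotient.mk (isIsomorphicSetoid C) X

variable {C} in
/-- The structure constant `F_{XY}^L`, as an element of `ℚ(v)` depending on three
isomorphism classes. -/
def structConst (x y l : IsoClasses C) : CoeffField k :=
  ⟨toenConst t x.out y.out l.out, toenConst_mem k t _ _ _⟩

/-- `structConst` at `[X]`, `[Y]`, `[L]` is the number `F_{XY}^L` computed with
`X`, `Y`, `L` themselves. -/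
lemma structConst_isoClass (X Y L : C) :
    (structConst k t (isoClass X) (isoClass Y) (isoClass L) : ℝ) = toenConst t X Y L := by
  obtain ⟨a⟩ : IsIsomorphic (isoClass X).out X :=
    Quotient.exact (Quotient.out_eq (isoClass X))
  obtain ⟨c⟩ : IsIsomorphic (isoClass Y).out Y :=
    Quotient.exact (Quotient.out_eq (isoClass Y))
  obtain ⟨b⟩ : IsIsomorphic (isoClass L).out L :=
    Quotient.exact (Quotient.out_eq (isoClass L))
  exact toenConst_congr t a c b

/-- `H(C)`: the `ℚ(v)`-vector space with basis indexed by the isomorphism classes of `C`. -/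
abbrev HallSpace : Type u := IsoClasses C →₀ CoeffField k

variable {C} in
/-- The basis vector `u_{[X]}` of `H(C)`. -/
def basisVec (x : IsoClasses C) : HallSpace k C := Finsupp.single x 1

/-- The `ℚ(v)`-bilinear multiplication of `H(C)`, determined on the basis by
`u_{[X]} * u_{[Y]} = ∑_{[L]} F_{XY}^L u_{[L]}`. -/
def hallMul : HallSpace k C →ₗ[CoeffField k] HallSpace k C →ₗ[CoeffField k] HallSpace k C :=
  Finsupp.linearCombination (CoeffField k) fun x : IsoClasses C =>
    Finsupp.linearCombination (CoeffField k) fun y : IsoClasses C =>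
      ∑ᶠ l : IsoClasses C, structConst k t x y l • basisVec k l

lemma hallMul_basisVec (x y : IsoClasses C) :
    hallMul k t C (basisVec k x) (basisVec k y) =
      ∑ᶠ l : IsoClasses C, structConst k t x y l • basisVec k l := by
  simp [hallMul, basisVec, Finsupp.linearCombination_single]

end HallSpace

end PeriodicHall

end

/-!
Write `⟨X, L⟩ = (∏_{i=1}^t |Hom(X[i],L)|^{(-1)^i})^{1/2}`, so that
`F_{XY}^L = |(X,L)_Y| / |Aut X| * ⟨X,L⟩ / ⟨X,X⟩`. Because the period `t` is odd, the long exact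
sequences of a distinguished triangle `X ⟶ L ⟶ Y ⟶ X[1]` give
`⟨W,L⟩ = ⟨W,X⟩ ⟨W,Y⟩ |ker(Hom(W,X) → Hom(W,L))|` and the dual formula
(`pairing_triangle_left`, `pairing_triangle_right`).

Let `(α, β, γ)` be a distinguished triangle `L ⟶ N ⟶ K ⟶ L[1]`. The stabilizer of `α` in `Aut L`
consists of the invertible `1 + sγ`, that of `β` in `Aut K` of the invertible `1 + γs`, with
`s : L[1] ⟶ K`; and `1 + sγ` is invertible iff `1 + γs` is. So the orders of the two stabilizers
differ only by the orders of the kernels of composition with `γ`, which the pairing computes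
(`stabCard_relation`). The `β` belonging to a given `α` form an `Aut K`-orbit, and the `α` belonging
to a given `β` an `Aut L`-orbit, whence by double counting
`|(L,N)_K| / |Aut L| * ⟨L,N⟩ / ⟨L,L⟩ = |(N,K)_{L[1]}| / |Aut K| * ⟨N,K⟩ / ⟨K,K⟩`,
also for subsets of morphisms that correspond to each other (`card_first_morphisms_eq`).

For associativity, apply this to the triangles `L ⟶ M ⊞ Y ⟶ K ⟶ L[1]`. By the octahedral axiom
(`comp_mem_homsWithCone_iff`) parallel sides of the square `L`, `M`, `Y`, `K` have isomorphic
cones, so the condition that the components `L ⟶ M` and `L ⟶ Y` have cones `Z` and `X[1]` is the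
same as the condition that `Y ⟶ K` and `M ⟶ K` have these cones. Summing the formula over all
isomorphism classes of `L` and `K` and dividing by `|Aut Y| ⟨Y,Y⟩`, one side becomes
`∑_L F_{XY}^L F_{LZ}^M` and the other `∑_K F_{YZ}^K F_{XK}^M` (`sum_toenConst_mul_eq`).
-/

set_option linter.unusedSectionVars false

noncomputable section

namespace PeriodicHall

/-! ### Counting in exact sequences -/

lemma natCard_eq_ker_mul_ker {G H K : Type*} [AddCommGroup G] [AddCommGroup H] [AddCommGroup K]
    (f : G →+ H) (g : H →+ K) (hfg : f.range = g.ker) :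
    Nat.card G = Nat.card f.ker * Nat.card g.ker := by
  rw [← hfg, ← f.ker.card_mul_index, AddSubgroup.index,
    Nat.card_congr (QuotientAddGroup.quotientKerEquivRange f).toEquiv]

/-- The alternating product of `a i * a (i - 1)` telescopes. -/
lemma prod_mul_pred_zpow_neg_one (a : ℕ → ℝ) (ha : ∀ i, a i ≠ 0) (n : ℕ) :
    ∏ i ∈ Finset.Icc 1 n, (a i * a (i - 1)) ^ ((-1 : ℤ) ^ i) =
      a n ^ ((-1 : ℤ) ^ n) * (a 0)⁻¹ := by
  induction n with
  | zero => simp [ha 0]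
  | succ n ih =>
    rw [Finset.prod_Icc_succ_top (by omega), ih, mul_zpow, Nat.add_sub_cancel, pow_succ]
    have := ha n
    rcases neg_one_pow_eq_or ℤ n with h | h <;> simp [h] <;> field_simp

/-- Numerical form of a long exact sequence of odd period `t`: `x`, `l`, `y` are the orders of the
terms and `a i` those of the kernels of the maps out of the `x`-terms. For odd `t` the two ends of
the telescoping product enter with the same exponent, hence contribute `(a 0) ^ 2` rather than
cancelling, and the square root leaves `a 0`. -/
lemma sqrt_altProd_eq {t : ℕ} (ht : Odd t) {x l y a : ℕ → ℝ} (hx : ∀ i, 0 < x i)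
    (hy : ∀ i, 0 < y i) (ha : ∀ i, 0 < a i)
    (h : ∀ i, 1 ≤ i → x i * y i = l i * (a i * a (i - 1))) (hat : a t = a 0) :
    Real.sqrt (∏ i ∈ Finset.Icc 1 t, l i ^ ((-1 : ℤ) ^ i)) =
      Real.sqrt (∏ i ∈ Finset.Icc 1 t, x i ^ ((-1 : ℤ) ^ i)) *
        Real.sqrt (∏ i ∈ Finset.Icc 1 t, y i ^ ((-1 : ℤ) ^ i)) * a 0 := by
  have hpos : ∀ z : ℕ → ℝ, (∀ i, 0 < z i) →
      0 < ∏ i ∈ Finset.Icc 1 t, z i ^ ((-1 : ℤ) ^ i) :=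
    fun z hz => Finset.prod_pos fun i _ => zpow_pos (hz i) _
  have key : (∏ i ∈ Finset.Icc 1 t, x i ^ ((-1 : ℤ) ^ i)) *
      (∏ i ∈ Finset.Icc 1 t, y i ^ ((-1 : ℤ) ^ i)) * a 0 ^ 2 =
      ∏ i ∈ Finset.Icc 1 t, l i ^ ((-1 : ℤ) ^ i) := by
    have h1 : (∏ i ∈ Finset.Icc 1 t, x i ^ ((-1 : ℤ) ^ i)) *
        (∏ i ∈ Finset.Icc 1 t, y i ^ ((-1 : ℤ) ^ i)) =
        (∏ i ∈ Finset.Icc 1 t, l i ^ ((-1 : ℤ) ^ i)) *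
          ∏ i ∈ Finset.Icc 1 t, (a i * a (i - 1)) ^ ((-1 : ℤ) ^ i) := by
      rw [← Finset.prod_mul_distrib, ← Finset.prod_mul_distrib]
      refine Finset.prod_congr rfl fun i hi => ?_
      rw [← mul_zpow, ← mul_zpow, h i (Finset.mem_Icc.1 hi).1]
    rw [h1, prod_mul_pred_zpow_neg_one a (fun i => (ha i).ne'), ht.neg_one_pow, hat]
    have := (ha 0).ne'
    simp only [zpow_neg, zpow_one]
    field_simp
  rw [← key, Real.sqrt_mul (mul_pos (hpos x hx) (hpos y hy)).le, Real.sqrt_mul (hpos x hx).le,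
    Real.sqrt_sq (ha 0).le]

/-! ### The multiplicative pairing `⟨X, L⟩` -/

section Pairing

variable {C : Type u} [Category.{w} C] [HasShift C ℤ] [Preadditive C]

/-- The number of morphisms `W ⟶ X` which vanish after composition with `f : X ⟶ L`. -/
def postKerCard (W : C) {X L : C} (f : X ⟶ L) : ℕ := Nat.card (Preadditive.rightComp W f).ker

/-- The number of morphisms `Y ⟶ V` which vanish after precomposition with `g : L ⟶ Y`. -/
def preKerCard (V : C) {L Y : C} (g : L ⟶ Y) : ℕ := Nat.card (Preadditive.leftComp V g).ker

/-- The pairing `⟨X, L⟩ = (∏_{i=1}^t |Hom(X[i],L)|^{(-1)^i})^{1/2}`; the correction factor in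
`toenConst` is `⟨X, L⟩ / ⟨X, X⟩`. -/
def pairing (t : ℕ) (X L : C) : ℝ :=
  Real.sqrt (∏ i ∈ Finset.Icc 1 t, (Nat.card (X⟦(i : ℤ)⟧ ⟶ L) : ℝ) ^ ((-1 : ℤ) ^ i))

lemma postKerCard_congr {W W' X L : C} (e : W ≅ W') (f : X ⟶ L) :
    postKerCard W f = postKerCard W' f := by
  refine Nat.card_congr ⟨fun φ => ⟨e.inv ≫ φ.1, ?_⟩, fun φ => ⟨e.hom ≫ φ.1, ?_⟩, ?_, ?_⟩
  · have := φ.2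
    simp only [AddMonoidHom.mem_ker, Preadditive.rightComp, AddMonoidHom.mk'_apply] at this ⊢
    simp [this]
  · have := φ.2
    simp only [AddMonoidHom.mem_ker, Preadditive.rightComp, AddMonoidHom.mk'_apply] at this ⊢
    simp [this]
  · intro φ; ext; simp
  · intro φ; ext; simp

lemma preKerCard_congr {V V' L Y : C} (e : V ≅ V') (g : L ⟶ Y) :
    preKerCard V g = preKerCard V' g := by
  refine Nat.card_congr ⟨fun φ => ⟨φ.1 ≫ e.hom, ?_⟩, fun φ => ⟨φ.1 ≫ e.inv, ?_⟩, ?_, ?_⟩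
  · have := φ.2
    simp only [AddMonoidHom.mem_ker, Preadditive.leftComp, AddMonoidHom.mk'_apply] at this ⊢
    rw [← Category.assoc, this, zero_comp]
  · have := φ.2
    simp only [AddMonoidHom.mem_ker, Preadditive.leftComp, AddMonoidHom.mk'_apply] at this ⊢
    rw [← Category.assoc, this, zero_comp]
  · intro φ; ext; simp
  · intro φ; ext; simp

/-- The bijection `Hom(X, Y) ≃ Hom(X[n], Y[n])`. -/
def shiftHomEquiv (n : ℤ) (X Y : C) : (X ⟶ Y) ≃ (X⟦n⟧ ⟶ Y⟦n⟧) :=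
  (Functor.FullyFaithful.ofFullyFaithful (shiftFunctor C n)).homEquiv

@[simp]
lemma shiftHomEquiv_apply (n : ℤ) {X Y : C} (f : X ⟶ Y) : shiftHomEquiv n X Y f = f⟦n⟧' := rfl

lemma pairing_shift_shift (t : ℕ) (X L : C) (n : ℤ) :
    pairing t (X⟦n⟧) (L⟦n⟧) = pairing t X L := by
  have h : ∀ i : ℤ, Nat.card (X⟦n⟧⟦i⟧ ⟶ L⟦n⟧) = Nat.card (X⟦i⟧ ⟶ L) := fun i =>
    (Nat.card_congr ((shiftComm X n i).homCongr (Iso.refl _))).trans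
      (Nat.card_congr (shiftHomEquiv n (X⟦i⟧) L)).symm
  simp only [pairing, h]

lemma natCard_shift_hom (X V : C) (i : ℤ) :
    Nat.card (X⟦i⟧ ⟶ V) = Nat.card (X ⟶ V⟦-i⟧) :=
  (Nat.card_congr ((Iso.refl (X⟦i⟧)).homCongr (shiftNegShift V i).symm)).trans
    (Nat.card_congr (shiftHomEquiv i X (V⟦-i⟧))).symm

variable [∀ X Y : C, Finite (X ⟶ Y)]

lemma natCard_hom_pos (X Y : C) : (0 : ℝ) < Nat.card (X ⟶ Y) :=
  haveI : Nonempty (X ⟶ Y) := ⟨0⟩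
  Nat.cast_pos.2 Nat.card_pos

lemma postKerCard_pos (W : C) {X L : C} (f : X ⟶ L) : (0 : ℝ) < postKerCard W f :=
  Nat.cast_pos.2 Nat.card_pos

lemma preKerCard_pos (V : C) {L Y : C} (g : L ⟶ Y) : (0 : ℝ) < preKerCard V g :=
  Nat.cast_pos.2 Nat.card_pos

lemma pairing_pos (t : ℕ) (X L : C) : 0 < pairing t X L :=
  Real.sqrt_pos.2 (Finset.prod_pos fun _ _ => zpow_pos (natCard_hom_pos _ _) _)

lemma pairing_biprod (t : ℕ) (X M Y : C) [HasBinaryBiproduct M Y] :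
    pairing t X (M ⊞ Y) = pairing t X M * pairing t X Y := by
  have h : ∀ i : ℤ, Nat.card (X⟦i⟧ ⟶ M ⊞ Y) =
      Nat.card (X⟦i⟧ ⟶ M) * Nat.card (X⟦i⟧ ⟶ Y) := fun i => by
    rw [← Nat.card_prod]
    exact Nat.card_congr ⟨fun f => (f ≫ biprod.fst, f ≫ biprod.snd), fun p => biprod.lift p.1 p.2,
      fun f => by ext <;> simp, fun p => by simp⟩
  rw [pairing, pairing, pairing, ← Real.sqrt_mul
    (Finset.prod_pos fun _ _ => zpow_pos (natCard_hom_pos _ _) _).le, ← Finset.prod_mul_distrib]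
  simp only [h, Nat.cast_mul, mul_zpow]

lemma biprod_pairing (t : ℕ) (M Y V : C) [HasBinaryBiproduct M Y] :
    pairing t (M ⊞ Y) V = pairing t M V * pairing t Y V := by
  have h : ∀ i : ℤ, Nat.card ((M ⊞ Y)⟦i⟧ ⟶ V) =
      Nat.card (M⟦i⟧ ⟶ V) * Nat.card (Y⟦i⟧ ⟶ V) := fun i => by
    simp only [natCard_shift_hom]
    rw [← Nat.card_prod]
    exact Nat.card_congr ⟨fun f => (biprod.inl ≫ f, biprod.inr ≫ f), fun p => biprod.desc p.1 p.2,
      fun f => by ext <;> simp, fun p => by simp⟩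
  rw [pairing, pairing, pairing, ← Real.sqrt_mul
    (Finset.prod_pos fun _ _ => zpow_pos (natCard_hom_pos _ _) _).le, ← Finset.prod_mul_distrib]
  simp only [h, Nat.cast_mul, mul_zpow]

end Pairing

/-! ### The pairing along distinguished triangles -/

section TrianglePairing

variable {C : Type u} [Category.{w} C] [HasZeroObject C] [HasShift C ℤ] [Preadditive C]
  [∀ n : ℤ, (shiftFunctor C n).Additive] [Pretriangulated C]

/-- `W'` is only required to be isomorphic to `W[1]`, so that the lemma applies to `W[i]` and
`W[i - 1]` without rewriting shifts. -/
lemma postKerCard_map_shift {W W' X L : C} (e : W' ≅ W⟦(1 : ℤ)⟧) (f : X ⟶ L) :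
    postKerCard W' (f⟦(1 : ℤ)⟧') = postKerCard W f := by
  rw [postKerCard_congr e]
  refine (Nat.card_congr ((shiftHomEquiv 1 W X).subtypeEquiv fun φ => ?_)).symm
  simp only [AddMonoidHom.mem_ker, Preadditive.rightComp, AddMonoidHom.mk'_apply,
    shiftHomEquiv_apply, ← Functor.map_comp, Functor.map_eq_zero_iff]

lemma preKerCard_map_shift {V V' L Y : C} (e : V' ≅ V⟦(1 : ℤ)⟧) (g : L ⟶ Y) :
    preKerCard V' (g⟦(1 : ℤ)⟧') = preKerCard V g := by
  rw [preKerCard_congr e]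
  refine (Nat.card_congr ((shiftHomEquiv 1 Y V).subtypeEquiv fun φ => ?_)).symm
  simp only [AddMonoidHom.mem_ker, Preadditive.leftComp, AddMonoidHom.mk'_apply,
    shiftHomEquiv_apply, ← Functor.map_comp, Functor.map_eq_zero_iff]

section

variable {X L Y : C} {f : X ⟶ L} {g : L ⟶ Y} {h : Y ⟶ X⟦(1 : ℤ)⟧}

lemma natCard_hom_left (hT : Triangle.mk f g h ∈ distTriang C) (W : C) :
    Nat.card (W ⟶ X) = postKerCard W f * postKerCard W g := by
  refine natCard_eq_ker_mul_ker _ _ (le_antisymm ?_ ?_)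
  · rintro _ ⟨φ, rfl⟩
    have h0 : f ≫ g = 0 := comp_distTriang_mor_zero₁₂ _ hT
    simp [AddMonoidHom.mem_ker, Preadditive.rightComp, h0]
  · intro φ hφ
    obtain ⟨ψ, hψ⟩ := Triangle.coyoneda_exact₂ _ hT φ hφ
    exact ⟨ψ, hψ.symm⟩

lemma natCard_hom_right (hT : Triangle.mk f g h ∈ distTriang C) (V : C) :
    Nat.card (Y ⟶ V) = preKerCard V g * preKerCard V f := by
  refine natCard_eq_ker_mul_ker _ _ (le_antisymm ?_ ?_)
  · rintro _ ⟨φ, rfl⟩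
    have h0 : f ≫ g = 0 := comp_distTriang_mor_zero₁₂ _ hT
    simp [AddMonoidHom.mem_ker, Preadditive.leftComp, reassoc_of% h0]
  · intro φ hφ
    obtain ⟨ψ, hψ⟩ := Triangle.yoneda_exact₂ _ hT φ hφ
    exact ⟨ψ, hψ.symm⟩

lemma preKerCard_neg (V : C) (f : X ⟶ L) : preKerCard V (-f) = preKerCard V f := by
  simp [preKerCard, Preadditive.leftComp, AddMonoidHom.ker]

lemma postKerCard_neg (V : C) (f : X ⟶ L) : postKerCard V (-f) = postKerCard V f := by
  simp [postKerCard, Preadditive.rightComp, AddMonoidHom.ker]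

end

end TrianglePairing

section LongExact

variable {C : Type u} [Category.{w} C] [HasZeroObject C] [HasShift C ℤ] [Preadditive C]
  [∀ n : ℤ, (shiftFunctor C n).Additive] [Pretriangulated C]
  [∀ X Y : C, Finite (X ⟶ Y)] {t : ℕ}
  {X L Y : C} {f : X ⟶ L} {g : L ⟶ Y} {h : Y ⟶ X⟦(1 : ℤ)⟧}

/-- `⟨W, L⟩ = ⟨W, X⟩ ⟨W, Y⟩ κ`, where `κ` is the number of morphisms `W ⟶ X` killed by
`f : X ⟶ L`: the long exact sequence of `Hom(W[i], -)`. -/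
theorem pairing_triangle_left (ht : Odd t) (e : shiftFunctor C (t : ℤ) ≅ 𝟭 C)
    (hT : Triangle.mk f g h ∈ distTriang C) (W : C) :
    pairing t W L = pairing t W X * pairing t W Y * postKerCard W f := by
  have hT1 : Triangle.mk g h (-f⟦(1 : ℤ)⟧') ∈ distTriang C := rot_of_distTriang _ hT
  have hT2 : Triangle.mk h (-f⟦(1 : ℤ)⟧') (-g⟦(1 : ℤ)⟧') ∈ distTriang C :=
    rot_of_distTriang _ hT1
  have h0 : postKerCard W f = postKerCard (W⟦((0 : ℕ) : ℤ)⟧) f :=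
    postKerCard_congr ((shiftFunctorZero C ℤ).app W).symm f
  rw [h0]
  refine sqrt_altProd_eq (a := fun i => (postKerCard (W⟦(i : ℤ)⟧) f : ℝ)) ht
    (fun i => natCard_hom_pos _ _) (fun i => natCard_hom_pos _ _)
    (fun i => postKerCard_pos _ _) (fun i hi => ?_) ?_
  · have e1 : W⟦(i : ℤ)⟧ ≅ W⟦((i - 1 : ℕ) : ℤ)⟧⟦(1 : ℤ)⟧ :=
      (shiftFunctorAdd' C ((i - 1 : ℕ) : ℤ) 1 i (by omega)).app W
    rw [natCard_hom_left hT, natCard_hom_left hT1, natCard_hom_left hT2, postKerCard_neg,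
      postKerCard_map_shift e1]
    push_cast
    ring
  · exact congrArg _ (postKerCard_congr (e.app W ≪≫ ((shiftFunctorZero C ℤ).app W).symm) f)

/-- `⟨L, V⟩ = ⟨X, V⟩ ⟨Y, V⟩ κ`, where `κ` is the number of morphisms `Y ⟶ V` killed by
`g : L ⟶ Y`. With `Hom(X[i], V)` rewritten as `Hom(X, V[-i])`, the triangle itself need not be
shifted. -/
theorem pairing_triangle_right (ht : Odd t) (e : shiftFunctor C (t : ℤ) ≅ 𝟭 C)
    (hT : Triangle.mk f g h ∈ distTriang C) (V : C) :
    pairing t L V = pairing t X V * pairing t Y V * preKerCard V g := by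
  have hT1 : Triangle.mk g h (-f⟦(1 : ℤ)⟧') ∈ distTriang C := rot_of_distTriang _ hT
  have hT2 : Triangle.mk h (-f⟦(1 : ℤ)⟧') (-g⟦(1 : ℤ)⟧') ∈ distTriang C :=
    rot_of_distTriang _ hT1
  have h0 : preKerCard V g = preKerCard (V⟦-((0 : ℕ) : ℤ)⟧) g :=
    preKerCard_congr ((shiftFunctorZero' C (-((0 : ℕ) : ℤ)) (by simp)).app V).symm g
  rw [h0]
  refine sqrt_altProd_eq (a := fun i => (preKerCard (V⟦-(i : ℤ)⟧) g : ℝ)) ht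
    (fun i => natCard_hom_pos _ _) (fun i => natCard_hom_pos _ _)
    (fun i => preKerCard_pos _ _) (fun i hi => ?_) ?_
  · have e1 : V⟦-((i - 1 : ℕ) : ℤ)⟧ ≅ V⟦-(i : ℤ)⟧⟦(1 : ℤ)⟧ :=
      (shiftFunctorAdd' C (-(i : ℤ)) 1 (-((i - 1 : ℕ) : ℤ)) (by omega)).app V
    simp only [natCard_shift_hom]
    rw [Nat.card_congr (shiftHomEquiv 1 X (V⟦-(i : ℤ)⟧)),
      Nat.card_congr (shiftHomEquiv 1 L (V⟦-(i : ℤ)⟧)), natCard_hom_right hT,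
      natCard_hom_right hT1, natCard_hom_right hT2, preKerCard_neg,
      preKerCard_map_shift (Iso.refl _), preKerCard_congr e1]
    push_cast
    ring
  · refine congrArg _ (preKerCard_congr ?_ g)
    exact (e.app (V⟦-(t : ℤ)⟧)).symm ≪≫ shiftNegShift V (t : ℤ) ≪≫
      ((shiftFunctorZero' C (-((0 : ℕ) : ℤ)) (by simp)).app V).symm

end LongExact

/-! ### Stabilizers of the morphisms of a distinguished triangle -/

section Stabilizers

variable {C : Type u} [Category.{w} C] [Preadditive C]

/-- If `r` is the inverse of `1 + sγ`, then `1 - γrs` is the inverse of `1 + γs`. -/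
lemma isIso_id_add_comp {A B : C} (s : A ⟶ B) (γ : B ⟶ A) (h : IsIso (𝟙 A + s ≫ γ)) :
    IsIso (𝟙 B + γ ≫ s) := by
  set r := inv (𝟙 A + s ≫ γ)
  have h1 : s ≫ γ ≫ r = 𝟙 A - r := by
    have : (𝟙 A + s ≫ γ) ≫ r = 𝟙 A := IsIso.hom_inv_id _
    rw [Preadditive.add_comp, Category.id_comp, Category.assoc] at this
    rw [← this]; abel
  have h2 : r ≫ s ≫ γ = 𝟙 A - r := by
    have : r ≫ (𝟙 A + s ≫ γ) = 𝟙 A := IsIso.inv_hom_id _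
    rw [Preadditive.comp_add, Category.comp_id] at this
    rw [← this]; abel
  refine ⟨𝟙 B - γ ≫ r ≫ s, ?_, ?_⟩
  · have : γ ≫ s ≫ γ ≫ r ≫ s = γ ≫ s - γ ≫ r ≫ s := by
      rw [reassoc_of% h1]; simp
    simp [this]
  · have : γ ≫ r ≫ s ≫ γ ≫ s = γ ≫ s - γ ≫ r ≫ s := by
      rw [reassoc_of% h2]; simp
    simp [this]

lemma isIso_id_add_comp_iff {A B : C} (s : A ⟶ B) (γ : B ⟶ A) :
    IsIso (𝟙 A + s ≫ γ) ↔ IsIso (𝟙 B + γ ≫ s) :=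
  ⟨isIso_id_add_comp s γ, isIso_id_add_comp γ s⟩

/-- Each fibre of an additive map over a point of its range is a coset of the kernel. -/
lemma natCard_preimage_eq {G H : Type*} [AddCommGroup G] [AddCommGroup H] [Finite G]
    (φ : G →+ H) (S : Set H) (hS : S ⊆ Set.range φ) :
    Nat.card (φ ⁻¹' S) = Nat.card S * Nat.card φ.ker := by
  rw [← Nat.card_prod]
  choose r hr using fun s : S => hS s.2
  refine Nat.card_congr ⟨fun g => (⟨φ g.1, g.2⟩, ⟨g.1 - r ⟨φ g.1, g.2⟩, ?_⟩),
    fun p => ⟨r p.1 + p.2.1, ?_⟩, fun g => ?_, fun p => ?_⟩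
  · simp [AddMonoidHom.mem_ker, hr]
  · have := p.2.2
    rw [AddMonoidHom.mem_ker] at this
    simp [this, hr]
  · simp
  · obtain ⟨s, k, hk⟩ := p
    rw [AddMonoidHom.mem_ker] at hk
    have h1 : φ (r s + k) = s := by simp [hk, hr]
    ext <;> simp [h1]

/-- The number of automorphisms `u` of `L` with `u ≫ α = α`. -/
def leftStabCard {L N : C} (α : L ⟶ N) : ℕ := Nat.card {u : L ≅ L // u.hom ≫ α = α}

/-- The number of automorphisms `u` of `N` with `β ≫ u = β`. -/
def rightStabCard {M N : C} (β : M ⟶ N) : ℕ := Nat.card {u : N ≅ N // β ≫ u.hom = β}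

lemma leftStabCard_eq {L N : C} (α : L ⟶ N) :
    leftStabCard α = Nat.card {n : L ⟶ L | IsIso (𝟙 L + n) ∧ n ≫ α = 0} := by
  refine Nat.card_congr ⟨fun u => ⟨u.1.hom - 𝟙 L, ?_⟩,
    fun n => ⟨@asIso _ _ _ _ (𝟙 L + n.1) n.2.1, ?_⟩, fun u => ?_, fun n => ?_⟩
  · refine ⟨?_, ?_⟩
    · rw [add_sub_cancel]; exact Iso.isIso_hom u.1
    · simp [u.2]
  · have := n.2.2
    simp [this]
  · ext; simp
  · ext; simp

lemma rightStabCard_eq {M N : C} (β : M ⟶ N) :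
    rightStabCard β = Nat.card {n : N ⟶ N | IsIso (𝟙 N + n) ∧ β ≫ n = 0} := by
  refine Nat.card_congr ⟨fun u => ⟨u.1.hom - 𝟙 N, ?_⟩,
    fun n => ⟨@asIso _ _ _ _ (𝟙 N + n.1) n.2.1, ?_⟩, fun u => ?_, fun n => ?_⟩
  · refine ⟨?_, ?_⟩
    · rw [add_sub_cancel]; exact Iso.isIso_hom u.1
    · simp [u.2]
  · have := n.2.2
    simp [this]
  · ext; simp
  · ext; simp

end Stabilizers

section StabilizersTriangle

variable {C : Type u} [Category.{w} C] [HasZeroObject C] [HasShift C ℤ] [Preadditive C]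
  [∀ n : ℤ, (shiftFunctor C n).Additive] [Pretriangulated C]
  [∀ X Y : C, Finite (X ⟶ Y)] {t : ℕ}
  {L N K : C} {α : L ⟶ N} {β : N ⟶ K} {γ : K ⟶ L⟦(1 : ℤ)⟧}

/-- An automorphism `u` of `L` fixes `α` iff `u[1] = 1 + sγ` for some `s : L[1] ⟶ K`. -/
lemma leftStabCard_mul_postKerCard (hT : Triangle.mk α β γ ∈ distTriang C) :
    leftStabCard α * postKerCard (L⟦(1 : ℤ)⟧) γ =
      Nat.card {s : L⟦(1 : ℤ)⟧ ⟶ K // IsIso (𝟙 (L⟦(1 : ℤ)⟧) + s ≫ γ)} := by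
  have h1 : leftStabCard α = Nat.card
      {n : L⟦(1 : ℤ)⟧ ⟶ L⟦(1 : ℤ)⟧ | IsIso (𝟙 _ + n) ∧ n ≫ α⟦(1 : ℤ)⟧' = 0} := by
    rw [leftStabCard_eq]
    refine Nat.card_congr ((shiftHomEquiv 1 L L).subtypeEquiv fun n => ?_)
    change (IsIso (𝟙 L + n) ∧ n ≫ α = 0) ↔
      (IsIso (𝟙 _ + n⟦(1 : ℤ)⟧') ∧ n⟦(1 : ℤ)⟧' ≫ α⟦(1 : ℤ)⟧' = 0)
    rw [← Functor.map_comp, Functor.map_eq_zero_iff, ← CategoryTheory.Functor.map_id,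
      ← Functor.map_add, isIso_iff_of_reflects_iso]
  rw [h1, postKerCard, ← natCard_preimage_eq]
  · refine Nat.card_congr (Equiv.subtypeEquivRight fun s => ?_)
    have h0 : γ ≫ α⟦(1 : ℤ)⟧' = 0 := comp_distTriang_mor_zero₃₁ _ hT
    simp [Preadditive.rightComp, h0]
  · rintro n ⟨-, hn⟩
    obtain ⟨s, hs⟩ := Triangle.coyoneda_exact₁ _ hT n hn
    exact ⟨s, hs.symm⟩

/-- An automorphism `u` of `K` fixes `β` iff `u = 1 + γs` for some `s : L[1] ⟶ K`. -/
lemma rightStabCard_mul_preKerCard (hT : Triangle.mk α β γ ∈ distTriang C) :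
    rightStabCard β * preKerCard K γ =
      Nat.card {s : L⟦(1 : ℤ)⟧ ⟶ K // IsIso (𝟙 K + γ ≫ s)} := by
  rw [rightStabCard_eq, preKerCard, ← natCard_preimage_eq]
  · refine Nat.card_congr (Equiv.subtypeEquivRight fun s => ?_)
    have h0 : β ≫ γ = 0 := comp_distTriang_mor_zero₂₃ _ hT
    simp [Preadditive.leftComp, reassoc_of% h0]
  · rintro n ⟨-, hn⟩
    obtain ⟨s, hs⟩ := Triangle.yoneda_exact₃ _ hT n hn
    exact ⟨s, hs.symm⟩

/-- Since `1 + sγ` is invertible iff `1 + γs` is, the two stabilizers are images of the same set of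
morphisms `s`, with fibres the kernels of composition with `γ` on either side. The orders of these
kernels are given by the pairing, and the factor `⟨L[1], K⟩` common to both cancels. -/
theorem stabCard_relation (ht : Odd t) (e : shiftFunctor C (t : ℤ) ≅ 𝟭 C)
    (hT : Triangle.mk α β γ ∈ distTriang C) :
    (leftStabCard α : ℝ) * (pairing t L L / pairing t L N) =
      rightStabCard β * (pairing t K K / pairing t N K) := by
  have hT1 : Triangle.mk β γ (-α⟦(1 : ℤ)⟧') ∈ distTriang C := rot_of_distTriang _ hT
  have hT2 : Triangle.mk γ (-α⟦(1 : ℤ)⟧') (-β⟦(1 : ℤ)⟧') ∈ distTriang C :=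
    rot_of_distTriang _ hT1
  have h1 := pairing_triangle_left ht e hT2 (L⟦(1 : ℤ)⟧)
  have h2 := pairing_triangle_right ht e hT1 K
  have h3 : (leftStabCard α : ℝ) * postKerCard (L⟦(1 : ℤ)⟧) γ =
      rightStabCard β * preKerCard K γ := by
    rw [← Nat.cast_mul, ← Nat.cast_mul, leftStabCard_mul_postKerCard hT,
      rightStabCard_mul_preKerCard hT]
    simp only [isIso_id_add_comp_iff]
  simp only [pairing_shift_shift] at h1
  rw [h1, h2]
  have p1 := (pairing_pos t L N).ne'
  have p2 := (pairing_pos t N K).ne'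
  field_simp
  linear_combination (pairing t (L⟦(1 : ℤ)⟧) K) * h3

end StabilizersTriangle

/-! ### Mapping cones -/

section Cones

variable {C : Type u} [Category.{w} C] [HasZeroObject C] [HasShift C ℤ] [Preadditive C]
  [∀ n : ℤ, (shiftFunctor C n).Additive] [Pretriangulated C]

lemma distTriang_mk_of_iso {X L Y X' L' Y' : C} {f : X ⟶ L} {g : L ⟶ Y} {h : Y ⟶ X⟦(1 : ℤ)⟧}
    (hT : Triangle.mk f g h ∈ distTriang C) {f' : X' ⟶ L'} {g' : L' ⟶ Y'}
    {h' : Y' ⟶ X'⟦(1 : ℤ)⟧} (a : X' ≅ X) (b : L' ≅ L) (c : Y' ≅ Y)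
    (h₁ : f' ≫ b.hom = a.hom ≫ f) (h₂ : g' ≫ c.hom = b.hom ≫ g)
    (h₃ : h' ≫ a.hom⟦(1 : ℤ)⟧' = c.hom ≫ h) : Triangle.mk f' g' h' ∈ distTriang C :=
  isomorphic_distinguished _ hT _ (Triangle.isoMk _ _ a b c h₁ h₂ h₃)

lemma mem_homsWithCone_iff {X L Y : C} (f : X ⟶ L) :
    f ∈ homsWithCone X L Y ↔
      ∃ (g : L ⟶ Y) (h : Y ⟶ X⟦(1 : ℤ)⟧), Triangle.mk f g h ∈ distTriang C := by
  constructor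
  · rintro ⟨Z, g, h, hT, ⟨e⟩⟩
    exact ⟨g ≫ e.hom, e.inv ≫ h, distTriang_mk_of_iso hT (Iso.refl _) (Iso.refl _) e.symm (by simp)
      (by simp) (by simp)⟩
  · rintro ⟨g, h, hT⟩
    exact ⟨Y, g, h, hT, ⟨Iso.refl _⟩⟩

lemma mem_homsWithCone_of_iso {X L Y Y' : C} {f : X ⟶ L} (hf : f ∈ homsWithCone X L Y)
    (e : Y ≅ Y') : f ∈ homsWithCone X L Y' := by
  obtain ⟨Z, g, h, hT, ⟨e'⟩⟩ := hf
  exact ⟨Z, g, h, hT, ⟨e' ≪≫ e⟩⟩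

lemma exists_mem_homsWithCone {X L : C} (f : X ⟶ L) : ∃ Y, f ∈ homsWithCone X L Y := by
  obtain ⟨Y, g, h, hT⟩ := distinguished_cocone_triangle f
  exact ⟨Y, Y, g, h, hT, ⟨Iso.refl _⟩⟩

lemma cone_unique {X L Y Y' : C} {f : X ⟶ L} (hf : f ∈ homsWithCone X L Y)
    (hf' : f ∈ homsWithCone X L Y') : Nonempty (Y ≅ Y') := by
  rw [mem_homsWithCone_iff] at hf hf'
  obtain ⟨g, h, hT⟩ := hf
  obtain ⟨g', h', hT'⟩ := hf'
  exact ⟨Triangle.π₃.mapIso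
    (isoTriangleOfIso₁₂ _ _ hT hT' (Iso.refl _) (Iso.refl _)
      ((Category.comp_id f).trans (Category.id_comp f).symm))⟩

/-- A morphism has cone `L[1]` iff it is the second morphism of a distinguished triangle starting
at `L`. -/
lemma mem_homsWithCone_shift_iff {L N K : C} (β : N ⟶ K) :
    β ∈ homsWithCone N K (L⟦(1 : ℤ)⟧) ↔
      ∃ (α : L ⟶ N) (γ : K ⟶ L⟦(1 : ℤ)⟧), Triangle.mk α β γ ∈ distTriang C := by
  rw [mem_homsWithCone_iff]
  constructor
  · rintro ⟨γ, δ, hT⟩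
    refine ⟨-(shiftFunctor C (1 : ℤ)).preimage δ, γ, ?_⟩
    rw [rotate_distinguished_triangle]
    change Triangle.mk β γ (-(-(shiftFunctor C (1 : ℤ)).preimage δ)⟦(1 : ℤ)⟧') ∈ distTriang C
    rwa [Functor.map_neg, Functor.map_preimage, neg_neg]
  · rintro ⟨α, γ, hT⟩
    exact ⟨γ, _, rot_of_distTriang _ hT⟩

/-- For distinguished triangles `L ⟶ N ⟶ K` and `Y ⟶ N ⟶ M`, the composites `L ⟶ N ⟶ M` and
`Y ⟶ N ⟶ K` have the same cones. The octahedral axiom for `α ≫ p` produces a triangle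
`K ⟶ cone (α ≫ p) ⟶ Y[1] ⟶ K[1]` whose last morphism is `-(i ≫ β)[1]`. -/
lemma comp_mem_homsWithCone_iff [IsTriangulated C] {L N K Y M : C} {α : L ⟶ N} {β : N ⟶ K}
    {γ : K ⟶ L⟦(1 : ℤ)⟧} (hT : Triangle.mk α β γ ∈ distTriang C) {i : Y ⟶ N} {p : N ⟶ M}
    {δ : M ⟶ Y⟦(1 : ℤ)⟧} (hT' : Triangle.mk i p δ ∈ distTriang C) (Z : C) :
    α ≫ p ∈ homsWithCone L M Z ↔ i ≫ β ∈ homsWithCone Y K Z := by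
  obtain ⟨W, v₁₃, w₁₃, hW⟩ := distinguished_cocone_triangle (α ≫ p)
  have hp : Triangle.mk p δ (-i⟦(1 : ℤ)⟧') ∈ distTriang C := rot_of_distTriang _ hT'
  obtain ⟨o⟩ := IsTriangulated.octahedron_axiom (u₁₂ := α) (u₂₃ := p) rfl hT hp hW
  have h1 : α ≫ p ∈ homsWithCone L M W := ⟨W, _, _, hW, ⟨Iso.refl _⟩⟩
  have h2 : i ≫ β ∈ homsWithCone Y K W := by
    refine ⟨W, o.m₁, o.m₃, ?_, ⟨Iso.refl _⟩⟩
    rw [rotate_distinguished_triangle]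
    have hm := o.mem
    rw [Preadditive.neg_comp, ← Functor.map_comp] at hm
    exact hm
  constructor
  · intro h
    obtain ⟨e⟩ := cone_unique h1 h
    exact mem_homsWithCone_of_iso h2 e
  · intro h
    obtain ⟨e⟩ := cone_unique h2 h
    exact mem_homsWithCone_of_iso h1 e

lemma biprod_inr_fst_distinguished (M Y : C) :
    Triangle.mk (biprod.inr : Y ⟶ M ⊞ Y) biprod.fst (0 : M ⟶ Y⟦(1 : ℤ)⟧) ∈ distTriang C :=
  distTriang_mk_of_iso (binaryBiproductTriangle_distinguished Y M) (Iso.refl _)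
    (biprod.braiding M Y) (Iso.refl _) (by ext <;> simp) (by simp) (by simp)

lemma mem_homsWithCone_zero_iff {X L : C} (f : X ⟶ L) : f ∈ homsWithCone X L 0 ↔ IsIso f := by
  rw [mem_homsWithCone_iff]
  constructor
  · rintro ⟨g, h, hT⟩
    exact (Triangle.isZero₃_iff_isIso₁ _ hT).1 (isZero_zero C)
  · intro hf
    exact ⟨0, 0, (Triangle.distinguished_iff_of_isZero₃ _ (isZero_zero C)).2 hf⟩

lemma zero_mem_homsWithCone_iff {L Y : C} (f : 0 ⟶ L) :
    f ∈ homsWithCone 0 L Y ↔ Nonempty (L ≅ Y) := by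
  rw [mem_homsWithCone_iff]
  constructor
  · rintro ⟨g, h, hT⟩
    have : IsIso g := (Triangle.isZero₁_iff_isIso₂ _ hT).1 (isZero_zero C)
    exact ⟨asIso g⟩
  · rintro ⟨e⟩
    exact ⟨e.hom, 0, (Triangle.distinguished_iff_of_isZero₁ _ (isZero_zero C)).2
      (inferInstanceAs (IsIso e.hom))⟩

end Cones

/-! ### Counting first against second morphisms of distinguished triangles -/

section DoubleCounting

/-- Weighted double counting of a relation between two finite types. The constants `gA`, `gB` will
be orders of automorphism groups and the weights `sA`, `sB` orders of stabilizers. -/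
lemma weighted_double_count {A B : Type*} [Fintype A] [Fintype B] (R : A → B → Prop)
    (P : A → Prop) (Q : B → Prop) (sA : A → ℕ) (sB : B → ℕ) (gA gB : ℕ) (cA cB : ℝ)
    [∀ a, DecidablePred (R a)] [∀ b, DecidablePred fun a => R a b]
    (hPQ : ∀ a b, R a b → (P a ↔ Q b))
    (hA : ∀ a, P a → ∑ b with R a b, sB b = gB) (hB : ∀ b, Q b → ∑ a with R a b, sA a = gA)
    (h : ∀ a b, R a b → (sA a : ℝ) * cA = sB b * cB) :
    (Nat.card {a // P a} : ℝ) * gB * cB = Nat.card {b // Q b} * gA * cA := by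
  classical
  have h1 : ∑ a with P a, ∑ b with R a b, (sB b : ℝ) * cB = Nat.card {a // P a} * gB * cB := by
    rw [Nat.card_eq_fintype_card, Fintype.card_subtype, ← nsmul_eq_mul, smul_mul_assoc,
      ← Finset.sum_const]
    refine Finset.sum_congr rfl fun a ha => ?_
    rw [← Finset.sum_mul, ← Nat.cast_sum, hA a (Finset.mem_filter.1 ha).2]
  have h2 : ∑ b with Q b, ∑ a with R a b, (sA a : ℝ) * cA = Nat.card {b // Q b} * gA * cA := by
    rw [Nat.card_eq_fintype_card, Fintype.card_subtype, ← nsmul_eq_mul, smul_mul_assoc,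
      ← Finset.sum_const]
    refine Finset.sum_congr rfl fun b hb => ?_
    rw [← Finset.sum_mul, ← Nat.cast_sum, hB b (Finset.mem_filter.1 hb).2]
  rw [← h1, ← h2, Finset.sum_comm' (s' := fun b => Finset.univ.filter fun a => R a b)
    (t' := Finset.univ.filter Q)]
  · refine Finset.sum_congr rfl fun b _ => Finset.sum_congr rfl fun a ha => ?_
    exact (h a b (Finset.mem_filter.1 ha).2).symm
  · intro a b
    simp only [Finset.mem_filter, Finset.mem_univ, true_and]
    exact ⟨fun ⟨h1, h2⟩ => ⟨h2, (hPQ a b h2).1 h1⟩, fun ⟨h1, h2⟩ => ⟨(hPQ a b h1).2 h2, h1⟩⟩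

variable {C : Type u} [Category.{w} C] [HasZeroObject C] [HasShift C ℤ] [Preadditive C]
  [∀ n : ℤ, (shiftFunctor C n).Additive] [Pretriangulated C]

/-- The relation that `α` and `β` are the first two morphisms of a distinguished triangle. -/
def IsDistPair {L N K : C} (α : L ⟶ N) (β : N ⟶ K) : Prop :=
  ∃ γ : K ⟶ L⟦(1 : ℤ)⟧, Triangle.mk α β γ ∈ distTriang C

variable {L N K : C}

lemma IsDistPair.comp_iso {α : L ⟶ N} {β : N ⟶ K} (h : IsDistPair α β) (v : K ≅ K) :
    IsDistPair α (β ≫ v.hom) := by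
  obtain ⟨γ, hT⟩ := h
  exact ⟨v.inv ≫ γ, distTriang_mk_of_iso hT (Iso.refl _) (Iso.refl _) v.symm (by simp)
    (by simp) (by simp)⟩

lemma IsDistPair.iso_comp {α : L ⟶ N} {β : N ⟶ K} (h : IsDistPair α β) (v : L ≅ L) :
    IsDistPair (v.hom ≫ α) β := by
  obtain ⟨γ, hT⟩ := h
  exact ⟨γ ≫ v.inv⟦(1 : ℤ)⟧', distTriang_mk_of_iso hT v (Iso.refl _) (Iso.refl _) (by simp)
    (by simp) (by simp [← Functor.map_comp])⟩

lemma IsDistPair.exists_iso_right {α : L ⟶ N} {β β' : N ⟶ K} (h : IsDistPair α β)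
    (h' : IsDistPair α β') : ∃ v : K ≅ K, β ≫ v.hom = β' := by
  obtain ⟨γ, hT⟩ := h
  obtain ⟨γ', hT'⟩ := h'
  let e := isoTriangleOfIso₁₂ _ _ hT hT' (Iso.refl _) (Iso.refl _)
    ((Category.comp_id α).trans (Category.id_comp α).symm)
  refine ⟨Triangle.π₃.mapIso e, ?_⟩
  have h2 : e.hom.hom₂ = 𝟙 N := isoTriangleOfIso₁₂_hom_hom₂ ..
  have h3 := e.hom.comm₂
  rw [h2] at h3
  exact h3.trans (Category.id_comp β')

lemma IsDistPair.exists_iso_left {α α' : L ⟶ N} {β : N ⟶ K} (h : IsDistPair α β)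
    (h' : IsDistPair α' β) : ∃ v : L ≅ L, v.hom ≫ α = α' := by
  obtain ⟨γ, hT⟩ := h
  obtain ⟨γ', hT'⟩ := h'
  obtain ⟨a, h1, h2⟩ := complete_distinguished_triangle_morphism₁ _ _ hT' hT (𝟙 N) (𝟙 K)
    ((Category.comp_id β).trans (Category.id_comp β).symm)
  let φ : Triangle.mk α' β γ' ⟶ Triangle.mk α β γ :=
    { hom₁ := a, hom₂ := 𝟙 N, hom₃ := 𝟙 K, comm₁ := h1, comm₃ := h2,
      comm₂ := (Category.comp_id β).trans (Category.id_comp β).symm }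
  have : IsIso a := isIso₁_of_isIso₂₃ φ hT' hT (inferInstanceAs (IsIso (𝟙 N)))
    (inferInstanceAs (IsIso (𝟙 K)))
  exact ⟨@asIso C _ L L a this, h1.symm.trans (Category.comp_id α')⟩

variable [∀ X Y : C, Finite (X ⟶ Y)]

instance finite_iso (X Y : C) : Finite (X ≅ Y) :=
  Finite.of_injective (fun u : X ≅ Y => u.hom) fun _ _ h => Iso.ext h

instance (X : C) : Finite (Aut X) := finite_iso X X

lemma natCard_aut_pos (X : C) : (0 : ℝ) < Nat.card (Aut X) := Nat.cast_pos.2 Nat.card_pos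

open Classical in
/-- The `β'` completing `α` to a distinguished triangle form an orbit of `Aut K`, and the sum over
an orbit of the orders of the stabilizers is the order of the group. -/
lemma sum_rightStabCard [Fintype (N ⟶ K)] {α : L ⟶ N} {β : N ⟶ K} (h : IsDistPair α β) :
    ∑ β' : N ⟶ K with IsDistPair α β', rightStabCard β' = Nat.card (K ≅ K) := by
  have := Fintype.ofFinite (K ≅ K)
  rw [Nat.card_eq_fintype_card, ← Finset.card_univ,
    Finset.card_eq_sum_card_fiberwise (f := fun v : K ≅ K => β ≫ v.hom)
      (t := Finset.univ.filter fun β' => IsDistPair α β') (fun v _ => by simpa using h.comp_iso v)]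
  refine Finset.sum_congr rfl fun β' hβ' => ?_
  obtain ⟨v₀, rfl⟩ := h.exists_iso_right (Finset.mem_filter.1 hβ').2
  rw [← Fintype.card_subtype, ← Nat.card_eq_fintype_card]
  refine Nat.card_congr ⟨fun u => ⟨v₀ ≪≫ u.1, ?_⟩, fun v => ⟨v₀.symm ≪≫ v.1, ?_⟩, fun u => ?_,
    fun v => ?_⟩
  · have := u.2
    simpa using this
  · have := v.2
    simpa using this
  · ext; simp
  · ext; simp

open Classical in
/-- The counterpart of `sum_rightStabCard` for the orbit of `Aut L` on the morphisms `α'`. -/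
lemma sum_leftStabCard [Fintype (L ⟶ N)] {α : L ⟶ N} {β : N ⟶ K} (h : IsDistPair α β) :
    ∑ α' : L ⟶ N with IsDistPair α' β, leftStabCard α' = Nat.card (L ≅ L) := by
  have := Fintype.ofFinite (L ≅ L)
  rw [Nat.card_eq_fintype_card, ← Finset.card_univ,
    Finset.card_eq_sum_card_fiberwise (f := fun v : L ≅ L => v.hom ≫ α)
      (t := Finset.univ.filter fun α' => IsDistPair α' β) (fun v _ => by simpa using h.iso_comp v)]
  refine Finset.sum_congr rfl fun α' hα' => ?_
  obtain ⟨v₀, rfl⟩ := h.exists_iso_left (Finset.mem_filter.1 hα').2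
  rw [← Fintype.card_subtype, ← Nat.card_eq_fintype_card]
  refine Nat.card_congr ⟨fun u => ⟨u.1 ≪≫ v₀, ?_⟩, fun v => ⟨v.1 ≪≫ v₀.symm, ?_⟩, fun u => ?_,
    fun v => ?_⟩
  · have := u.2
    simpa using this
  · have := v.2
    simp [this]
  · ext; simp
  · ext; simp

/-- A Riedtmann-type formula: the weighted number of morphisms `L ⟶ N` with cone `K` equals the
weighted number of morphisms `N ⟶ K` with cone `L[1]`, also after restriction to corresponding
properties `P` and `Q` of the two morphisms. -/
theorem card_first_morphisms_eq {t : ℕ} (ht : Odd t) (e : shiftFunctor C (t : ℤ) ≅ 𝟭 C)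
    (P : (L ⟶ N) → Prop) (Q : (N ⟶ K) → Prop)
    (hPQ : ∀ α β, IsDistPair α β → (P α ↔ Q β)) :
    (Nat.card {α // α ∈ homsWithCone L N K ∧ P α} : ℝ) / Nat.card (Aut L) *
        (pairing t L N / pairing t L L) =
      (Nat.card {β // β ∈ homsWithCone N K (L⟦(1 : ℤ)⟧) ∧ Q β} : ℝ) / Nat.card (Aut K) *
        (pairing t N K / pairing t K K) := by
  classical
  have := Fintype.ofFinite (L ⟶ N)
  have := Fintype.ofFinite (N ⟶ K)
  have key := weighted_double_count (fun (α : L ⟶ N) (β : N ⟶ K) => IsDistPair α β)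
    (fun α => α ∈ homsWithCone L N K ∧ P α)
    (fun β => β ∈ homsWithCone N K (L⟦(1 : ℤ)⟧) ∧ Q β)
    leftStabCard rightStabCard (Nat.card (Aut L)) (Nat.card (Aut K))
    (pairing t L L / pairing t L N) (pairing t K K / pairing t N K) ?_ ?_ ?_ ?_
  · have h1 := (pairing_pos t L N).ne'
    have h2 := (pairing_pos t L L).ne'
    have h3 := (pairing_pos t N K).ne'
    have h4 := (pairing_pos t K K).ne'
    have h5 := (natCard_aut_pos L).ne'
    have h6 := (natCard_aut_pos K).ne'
    field_simp at key ⊢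
    linear_combination key
  · intro α β h
    have hα : α ∈ homsWithCone L N K := by
      obtain ⟨γ, hT⟩ := h
      exact (mem_homsWithCone_iff α).2 ⟨β, γ, hT⟩
    have hβ : β ∈ homsWithCone N K (L⟦(1 : ℤ)⟧) := by
      obtain ⟨γ, hT⟩ := h
      exact (mem_homsWithCone_shift_iff β).2 ⟨α, γ, hT⟩
    rw [hPQ α β h]
    exact and_congr_left fun _ => iff_of_true hα hβ
  · rintro α ⟨hα, -⟩
    obtain ⟨β, γ, hT⟩ := (mem_homsWithCone_iff α).1 hα
    exact sum_rightStabCard (α := α) (β := β) ⟨γ, hT⟩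
  · rintro β ⟨hβ, -⟩
    obtain ⟨α, γ, hT⟩ := (mem_homsWithCone_shift_iff β).1 hβ
    exact sum_leftStabCard (α := α) (β := β) ⟨γ, hT⟩
  · rintro α β ⟨γ, hT⟩
    exact stabCard_relation ht e hT

lemma toenConst_eq (t : ℕ) (X Y L : C) : toenConst t X Y L =
    (Nat.card (homsWithCone X L Y) : ℝ) / Nat.card (Aut X) * (pairing t X L / pairing t X X) := by
  rw [toenConst, Finset.prod_div_distrib, Real.sqrt_div
    (Finset.prod_pos fun _ _ => zpow_pos (natCard_hom_pos _ _) _).le]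
  rfl

/-- The structure constant expressed through the second morphism of the triangles
`X ⟶ L ⟶ Y ⟶ X[1]`. -/
lemma toenConst_eq_right {t : ℕ} (ht : Odd t) (e : shiftFunctor C (t : ℤ) ≅ 𝟭 C) (X Y L : C) :
    toenConst t X Y L = (Nat.card (homsWithCone L Y (X⟦(1 : ℤ)⟧)) : ℝ) / Nat.card (Aut Y) *
      (pairing t L Y / pairing t Y Y) := by
  rw [toenConst_eq]
  simpa using card_first_morphisms_eq (L := X) (N := L) (K := Y) ht e (fun _ => True)
    (fun _ => True) (fun _ _ _ => Iff.rfl)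

lemma toenConst_ne_zero_iff (t : ℕ) (X Y L : C) :
    toenConst t X Y L ≠ 0 ↔ (homsWithCone X L Y).Nonempty := by
  have h1 := (pairing_pos t X L).ne'
  have h2 := (pairing_pos t X X).ne'
  have h3 := (natCard_aut_pos X).ne'
  rw [toenConst_eq, ← Set.nonempty_coe_sort, ← Finite.card_pos_iff, Nat.pos_iff_ne_zero]
  simp [h1, h2, h3]

end DoubleCounting

/-! ### Associativity, unit and finiteness for the structure constants -/

section ConeClasses

variable {C : Type u} [Category.{w} C] [HasZeroObject C] [HasShift C ℤ] [Preadditive C]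
  [∀ n : ℤ, (shiftFunctor C n).Additive] [Pretriangulated C]

lemma isoClass_eq_iff {X Y : C} : isoClass X = isoClass Y ↔ Nonempty (X ≅ Y) :=
  ⟨fun h => Quotient.exact h, fun h => Quotient.sound h⟩

lemma isoClass_out (l : IsoClasses C) : isoClass l.out = l := Quotient.out_eq l

/-- The isomorphism class of the cone of a morphism. -/
def coneClass {X L : C} (f : X ⟶ L) : IsoClasses C := isoClass (exists_mem_homsWithCone f).choose

lemma mem_homsWithCone_iff_coneClass {X L Y : C} (f : X ⟶ L) :
    f ∈ homsWithCone X L Y ↔ coneClass f = isoClass Y := by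
  have h := (exists_mem_homsWithCone f).choose_spec
  rw [coneClass, isoClass_eq_iff]
  exact ⟨fun hf => cone_unique h hf, fun ⟨e⟩ => mem_homsWithCone_of_iso h e⟩

lemma isoClass_shift_eq_iff {X Y : C} (n : ℤ) :
    isoClass (X⟦n⟧) = isoClass (Y⟦n⟧) ↔ isoClass X = isoClass Y := by
  rw [isoClass_eq_iff, isoClass_eq_iff]
  exact ⟨fun ⟨e⟩ => ⟨(shiftFunctor C n).preimageIso e⟩,
    fun ⟨e⟩ => ⟨(shiftFunctor C n).mapIso e⟩⟩

lemma exists_mem_homsWithCone_shift {N K : C} (β : N ⟶ K) :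
    ∃ L : C, β ∈ homsWithCone N K (L⟦(1 : ℤ)⟧) := by
  obtain ⟨L, α, γ, hT⟩ := distinguished_cocone_triangle₁ β
  exact ⟨L, (mem_homsWithCone_shift_iff β).2 ⟨α, γ, hT⟩⟩

/-- A finite set is partitioned by the fibres of a map to isomorphism classes, here given as a
relation `r a L` that determines the object `L` up to isomorphism. -/
lemma natCard_eq_sum_isoClasses {A : Type*} [Finite A] (P : A → Prop) (r : A → C → Prop)
    (hr : ∀ a, ∃ L, ∀ L', r a L' ↔ isoClass L = isoClass L') (S : Finset (IsoClasses C))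
    (hS : ∀ a L, P a → r a L → isoClass L ∈ S) :
    Nat.card {a // P a} = ∑ l ∈ S, Nat.card {a // r a l.out ∧ P a} := by
  classical
  have := Fintype.ofFinite A
  choose c hc using hr
  rw [Nat.card_eq_fintype_card, Fintype.card_subtype,
    Finset.card_eq_sum_card_fiberwise (f := fun a => isoClass (c a)) (t := S)
      (fun a ha => hS a _ (by simpa using ha) ((hc a (c a)).2 rfl))]
  refine Finset.sum_congr rfl fun l _ => ?_
  rw [Nat.card_eq_fintype_card, Fintype.card_subtype, Finset.filter_filter]
  simp only [hc, isoClass_out, and_comm]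

variable [∀ X Y : C, Finite (X ⟶ Y)] {t : ℕ}

/-- The associativity identity between structure constants. The finite sets `S` and `S'` contain the
supports of the two sums. -/
theorem sum_toenConst_mul_eq [IsTriangulated C] (ht : Odd t) (e : shiftFunctor C (t : ℤ) ≅ 𝟭 C)
    (X Y Z M : C) (S S' : Finset (IsoClasses C))
    (hS : ∀ L, toenConst t X Y L ≠ 0 → isoClass L ∈ S)
    (hS' : ∀ L, toenConst t Y Z L ≠ 0 → isoClass L ∈ S') :
    ∑ l ∈ S, toenConst t X Y l.out * toenConst t l.out Z M =
      ∑ l ∈ S', toenConst t Y Z l.out * toenConst t X l.out M := by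
  -- `A L K` and `B L K` count, through their first and their second morphism respectively, the
  -- triangles `L ⟶ M ⊞ Y ⟶ K ⟶ L[1]` attached to a homotopy cartesian square on `L`, `M`, `Y`, `K`
  let A (L K : C) : ℝ := Nat.card {α : L ⟶ M ⊞ Y // α ∈ homsWithCone L (M ⊞ Y) K ∧
    (α ≫ biprod.fst ∈ homsWithCone L M Z ∧ α ≫ biprod.snd ∈ homsWithCone L Y (X⟦(1 : ℤ)⟧))}
  let B (L K : C) : ℝ := Nat.card {β : M ⊞ Y ⟶ K //
    β ∈ homsWithCone (M ⊞ Y) K (L⟦(1 : ℤ)⟧) ∧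
    (biprod.inr ≫ β ∈ homsWithCone Y K Z ∧ biprod.inl ≫ β ∈ homsWithCone M K (X⟦(1 : ℤ)⟧))}
  -- the cones of parallel sides of a homotopy cartesian square agree
  have hPQ : ∀ {L K : C} (α : L ⟶ M ⊞ Y) (β : M ⊞ Y ⟶ K), IsDistPair α β →
      ((α ≫ biprod.fst ∈ homsWithCone L M Z ∧
        α ≫ biprod.snd ∈ homsWithCone L Y (X⟦(1 : ℤ)⟧)) ↔
      (biprod.inr ≫ β ∈ homsWithCone Y K Z ∧
        biprod.inl ≫ β ∈ homsWithCone M K (X⟦(1 : ℤ)⟧))) := by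
    rintro L K α β ⟨γ, hT⟩
    exact and_congr (comp_mem_homsWithCone_iff hT (biprod_inr_fst_distinguished M Y) Z)
      (comp_mem_homsWithCone_iff hT (binaryBiproductTriangle_distinguished M Y) _)
  have hAB : ∀ L K : C, A L K / Nat.card (Aut L) * (pairing t L (M ⊞ Y) / pairing t L L) =
      B L K / Nat.card (Aut K) * (pairing t (M ⊞ Y) K / pairing t K K) := fun L K =>
    card_first_morphisms_eq ht e _ _ hPQ
  have hA : ∀ L : C, (Nat.card (homsWithCone L M Z) : ℝ) *
      Nat.card (homsWithCone L Y (X⟦(1 : ℤ)⟧)) = ∑ l ∈ S', A L l.out := by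
    intro L
    rw [← Nat.cast_mul, ← Nat.card_prod, ← Nat.cast_sum, ← natCard_eq_sum_isoClasses
      (A := L ⟶ M ⊞ Y) (fun α => α ≫ biprod.fst ∈ homsWithCone L M Z ∧
        α ≫ biprod.snd ∈ homsWithCone L Y (X⟦(1 : ℤ)⟧)) (fun α K => α ∈ homsWithCone L (M ⊞ Y) K)]
    · refine congrArg _ (Nat.card_congr ⟨fun p => ⟨biprod.lift p.1.1 p.2.1, ?_⟩,
        fun α => (⟨_, α.2.1⟩, ⟨_, α.2.2⟩), fun p => by simp, fun α => ?_⟩)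
      · simp
      · ext <;> simp
    · exact fun α => ⟨_, fun K => mem_homsWithCone_iff_coneClass α⟩
    · intro α K hα hK
      obtain ⟨β, γ, hT⟩ := (mem_homsWithCone_iff α).1 hK
      exact hS' K ((toenConst_ne_zero_iff t Y Z K).2 ⟨_, ((hPQ α β ⟨γ, hT⟩).1 hα).1⟩)
  have hB : ∀ K : C, (Nat.card (homsWithCone Y K Z) : ℝ) *
      Nat.card (homsWithCone M K (X⟦(1 : ℤ)⟧)) = ∑ l ∈ S, B l.out K := by
    intro K
    rw [← Nat.cast_mul, ← Nat.card_prod, ← Nat.cast_sum, ← natCard_eq_sum_isoClasses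
      (A := M ⊞ Y ⟶ K) (fun β => biprod.inr ≫ β ∈ homsWithCone Y K Z ∧
        biprod.inl ≫ β ∈ homsWithCone M K (X⟦(1 : ℤ)⟧))
      (fun β L => β ∈ homsWithCone (M ⊞ Y) K (L⟦(1 : ℤ)⟧))]
    · refine congrArg _ (Nat.card_congr ⟨fun p => ⟨biprod.desc p.2.1 p.1.1, ?_⟩,
        fun α => (⟨_, α.2.1⟩, ⟨_, α.2.2⟩), fun p => by simp, fun α => ?_⟩)
      · simp
      · ext <;> simp
    · intro β
      obtain ⟨L, hL⟩ := exists_mem_homsWithCone_shift β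
      refine ⟨L, fun L' => ?_⟩
      rw [mem_homsWithCone_iff_coneClass] at hL ⊢
      rw [hL, isoClass_shift_eq_iff]
    · intro β L hβ hL
      obtain ⟨α, γ, hT⟩ := (mem_homsWithCone_shift_iff β).1 hL
      refine hS L ?_
      have h := ((hPQ α β ⟨γ, hT⟩).2 hβ).2
      obtain ⟨f, γ', hT'⟩ := (mem_homsWithCone_shift_iff _).1 h
      exact (toenConst_ne_zero_iff t X Y L).2 ⟨f, (mem_homsWithCone_iff f).2 ⟨_, _, hT'⟩⟩
  have hleft : ∀ L : C, toenConst t X Y L * toenConst t L Z M =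
      ∑ l ∈ S', A L l.out / Nat.card (Aut L) * (pairing t L (M ⊞ Y) / pairing t L L) *
        (Nat.card (Aut Y) * pairing t Y Y)⁻¹ := by
    intro L
    rw [← Finset.sum_mul, ← Finset.sum_mul, ← Finset.sum_div, ← hA, toenConst_eq_right ht e X Y L,
      toenConst_eq t L Z M, pairing_biprod, mul_inv]
    ring
  have hright : ∀ K : C, toenConst t Y Z K * toenConst t X K M =
      ∑ l ∈ S, B l.out K / Nat.card (Aut K) * (pairing t (M ⊞ Y) K / pairing t K K) *
        (Nat.card (Aut Y) * pairing t Y Y)⁻¹ := by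
    intro K
    rw [← Finset.sum_mul, ← Finset.sum_mul, ← Finset.sum_div, ← hB, toenConst_eq_right ht e X K M,
      toenConst_eq t Y Z K, biprod_pairing, mul_inv]
    ring
  simp only [hleft, hright, hAB]
  exact Finset.sum_comm

lemma pairing_zero_left (L : C) : pairing t (0 : C) L = 1 := by
  have h : ∀ i : ℤ, Nat.card ((0 : C)⟦i⟧ ⟶ L) = 1 := fun i => by
    have h0 : IsZero ((0 : C)⟦i⟧) := Functor.map_isZero _ (isZero_zero C)
    have : Unique ((0 : C)⟦i⟧ ⟶ L) := ⟨⟨0⟩, fun f => h0.eq_of_src _ _⟩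
    exact Nat.card_unique
  simp [pairing, h]

open Classical in
lemma toenConst_zero_left (Y L : C) :
    toenConst t (0 : C) Y L = if isoClass L = isoClass Y then 1 else 0 := by
  have hAut : Nat.card (Aut (0 : C)) = 1 := by
    have : Unique (Aut (0 : C)) :=
      ⟨⟨Iso.refl _⟩, fun f => Iso.ext ((isZero_zero C).eq_of_src _ _)⟩
    exact Nat.card_unique
  split_ifs with h
  · rw [isoClass_eq_iff] at h
    have : Unique (homsWithCone (0 : C) L Y) :=
      ⟨⟨⟨0, (zero_mem_homsWithCone_iff _).2 h⟩⟩,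
        fun f => Subtype.ext ((isZero_zero C).eq_of_src _ _)⟩
    simp [toenConst_eq, pairing_zero_left, hAut]
  · by_contra h0
    obtain ⟨f, hf⟩ := (toenConst_ne_zero_iff t _ _ _).1 h0
    exact h (isoClass_eq_iff.2 ((zero_mem_homsWithCone_iff f).1 hf))

open Classical in
lemma toenConst_zero_right (X L : C) :
    toenConst t X (0 : C) L = if isoClass L = isoClass X then 1 else 0 := by
  split_ifs with h
  · obtain ⟨a⟩ := isoClass_eq_iff.1 h
    rw [toenConst_congr t (Iso.refl X) (Iso.refl 0) a, toenConst_eq]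
    have h1 : Nat.card (homsWithCone X X (0 : C)) = Nat.card (Aut X) :=
      Nat.card_congr ⟨fun f => @asIso _ _ _ _ f.1 ((mem_homsWithCone_zero_iff f.1).1 f.2),
        fun u => ⟨Iso.hom u, (mem_homsWithCone_zero_iff _).2 (Iso.isIso_hom u)⟩,
        fun f => rfl, fun u => Iso.ext rfl⟩
    rw [h1, div_self (natCard_aut_pos X).ne', div_self (pairing_pos t X X).ne', mul_one]
  · by_contra h0
    obtain ⟨f, hf⟩ := (toenConst_ne_zero_iff t _ _ _).1 h0
    have := (mem_homsWithCone_zero_iff f).1 hf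
    exact h (isoClass_eq_iff.2 ⟨(asIso f).symm⟩)

/-- The object `L` is determined up to isomorphism by a morphism `Y ⟶ X[1]`, and there are finitely
many of these. -/
lemma finite_toenConst_ne_zero (X Y : C) :
    {l : IsoClasses C | toenConst t X Y l.out ≠ 0}.Finite := by
  have h : ∀ l : {l : IsoClasses C // toenConst t X Y l.out ≠ 0}, ∃ γ : Y ⟶ X⟦(1 : ℤ)⟧,
      ∃ (f : X ⟶ l.1.out) (g : l.1.out ⟶ Y), Triangle.mk f g γ ∈ distTriang C := by
    rintro ⟨l, hl⟩
    obtain ⟨f, hf⟩ := (toenConst_ne_zero_iff t _ _ _).1 hl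
    obtain ⟨g, γ, hT⟩ := (mem_homsWithCone_iff f).1 hf
    exact ⟨γ, f, g, hT⟩
  choose γ hγ using h
  refine Set.finite_coe_iff.1 (Finite.of_injective γ fun l l' hl => ?_)
  obtain ⟨f, g, hT⟩ := hγ l
  obtain ⟨f', g', hT'⟩ := hγ l'
  let a := isoTriangleOfIso₁₃ _ _ hT hT' (Iso.refl X) (Iso.refl Y)
    (by
      change γ l ≫ (𝟙 X)⟦(1 : ℤ)⟧' = 𝟙 Y ≫ γ l'
      rw [CategoryTheory.Functor.map_id, Category.comp_id, Category.id_comp, hl])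
  rw [Subtype.ext_iff, ← isoClass_out l.1, ← isoClass_out l'.1, isoClass_eq_iff]
  exact ⟨Triangle.π₂.mapIso a⟩

end ConeClasses

/-! ### The Hall algebra -/

section HallAlgebra

variable (k : Type z) [Field k] [Finite k] (t : ℕ)
variable {C : Type u} [Category.{w} C] [HasZeroObject C] [HasShift C ℤ] [Preadditive C]
  [Linear k C] [∀ n : ℤ, (shiftFunctor C n).Additive] [Pretriangulated C]
  [∀ X Y : C, Finite (X ⟶ Y)]

lemma coe_structConst (x y l : IsoClasses C) :
    (structConst k t x y l : ℝ) = toenConst t x.out y.out l.out := rfl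

lemma finite_structConst_ne_zero (x y : IsoClasses C) :
    {l : IsoClasses C | structConst k t x y l ≠ 0}.Finite := by
  have h := finite_toenConst_ne_zero (t := t) x.out y.out
  simpa only [← coe_structConst k, ne_eq, ZeroMemClass.coe_eq_zero] using h

lemma hallMul_basisVec_eq_sum (x y : IsoClasses C) :
    hallMul k t C (basisVec k x) (basisVec k y) =
      ∑ l ∈ (finite_structConst_ne_zero k t x y).toFinset,
        structConst k t x y l • basisVec k l := by
  rw [hallMul_basisVec]
  refine finsum_eq_sum_of_support_subset _ fun l hl => ?_
  simp only [Set.Finite.coe_toFinset, Set.mem_ofPred_eq]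
  intro h0
  exact hl (by simp [h0])

lemma hallMul_basisVec_apply (x y m : IsoClasses C) :
    hallMul k t C (basisVec k x) (basisVec k y) m = structConst k t x y m := by
  classical
  rw [hallMul_basisVec_eq_sum, Finsupp.finsetSum_apply]
  simp only [basisVec, Finsupp.smul_apply, Finsupp.single_apply, smul_eq_mul, mul_ite, mul_one,
    mul_zero, Finset.sum_ite_eq']
  by_cases h : structConst k t x y m = 0 <;> simp [h]

lemma smul_hallMul (r : CoeffField k) (a b : HallSpace k C) :
    hallMul k t C (r • a) b = r • hallMul k t C a b :=
  LinearMap.map_smul₂ _ r a b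

lemma hallMul_smul (r : CoeffField k) (a b : HallSpace k C) :
    hallMul k t C a (r • b) = r • hallMul k t C a b :=
  LinearMap.map_smul _ r b

theorem hallMul_basisVec_assoc [IsTriangulated C] (ht : Odd t)
    (e : shiftFunctor C (t : ℤ) ≅ 𝟭 C) (x y z : IsoClasses C) :
    hallMul k t C (hallMul k t C (basisVec k x) (basisVec k y)) (basisVec k z) =
      hallMul k t C (basisVec k x) (hallMul k t C (basisVec k y) (basisVec k z)) := by
  ext m
  rw [hallMul_basisVec_eq_sum k t x y, hallMul_basisVec_eq_sum k t y z]
  simp only [map_sum, map_smul, LinearMap.sum_apply, LinearMap.smul_apply, Finsupp.finsetSum_apply,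
    Finsupp.smul_apply, hallMul_basisVec_apply, smul_eq_mul]
  push_cast
  simp only [coe_structConst]
  have hmem : ∀ (x y : IsoClasses C) (L : C), toenConst t x.out y.out L ≠ 0 →
      isoClass L ∈ (finite_structConst_ne_zero k t x y).toFinset := by
    intro x y L hL
    rw [Set.Finite.mem_toFinset, Set.mem_ofPred_eq, ne_eq, ← ZeroMemClass.coe_eq_zero,
      ← isoClass_out x, ← isoClass_out y, structConst_isoClass]
    exact hL
  exact sum_toenConst_mul_eq ht e _ _ _ _ _ _ (hmem x y) (hmem y z)

lemma hallMul_zero_basisVec (y : IsoClasses C) :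
    hallMul k t C (basisVec k (isoClass (0 : C))) (basisVec k y) = basisVec k y := by
  classical
  ext m
  rw [hallMul_basisVec_apply, ← isoClass_out y, ← isoClass_out m, structConst_isoClass,
    toenConst_zero_left, basisVec, Finsupp.single_apply]
  simp only [eq_comm]
  split_ifs <;> simp

lemma hallMul_basisVec_zero (x : IsoClasses C) :
    hallMul k t C (basisVec k x) (basisVec k (isoClass (0 : C))) = basisVec k x := by
  classical
  ext m
  rw [hallMul_basisVec_apply, ← isoClass_out x, ← isoClass_out m, structConst_isoClass,
    toenConst_zero_right, basisVec, Finsupp.single_apply]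
  simp only [eq_comm]
  split_ifs <;> simp

theorem hallMul_assoc [IsTriangulated C] (ht : Odd t) (e : shiftFunctor C (t : ℤ) ≅ 𝟭 C)
    (a b c : HallSpace k C) :
    hallMul k t C (hallMul k t C a b) c = hallMul k t C a (hallMul k t C b c) := by
  have h : ∀ (x : IsoClasses C) (r : CoeffField k),
      (Finsupp.single x r : HallSpace k C) = r • basisVec k x := fun x r => by simp [basisVec]
  induction a using Finsupp.induction_linear with
  | zero => simp
  | add a a' h h' => simp only [map_add, LinearMap.add_apply, h, h']
  | single x r =>
    induction b using Finsupp.induction_linear with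
    | zero => simp
    | add b b' h h' => simp only [map_add, LinearMap.add_apply, h, h']
    | single y s =>
      induction c using Finsupp.induction_linear with
      | zero => simp
      | add c c' h h' => simp only [map_add, h, h']
      | single z q =>
        simp only [h, hallMul_smul, smul_hallMul, hallMul_basisVec_assoc k t ht e]

theorem hallMul_zero_left (a : HallSpace k C) :
    hallMul k t C (basisVec k (isoClass (0 : C))) a = a := by
  induction a using Finsupp.induction_linear with
  | zero => simp
  | add a a' h h' => rw [map_add, h, h']
  | single x r =>
    have h : (Finsupp.single x r : HallSpace k C) = r • basisVec k x := by simp [basisVec]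
    rw [h, hallMul_smul, hallMul_zero_basisVec]

theorem hallMul_zero_right (a : HallSpace k C) :
    hallMul k t C a (basisVec k (isoClass (0 : C))) = a := by
  induction a using Finsupp.induction_linear with
  | zero => simp
  | add a a' h h' => rw [map_add, LinearMap.add_apply, h, h']
  | single x r =>
    have h : (Finsupp.single x r : HallSpace k C) = r • basisVec k x := by simp [basisVec]
    rw [h, smul_hallMul, hallMul_basisVec_zero]

end HallAlgebra

end PeriodicHall

end

theorem theorem2p5 (k : Type z) [Field k] [Finite k]
    (C : Type u) [Category.{w} C] [HasZeroObject C]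
    [HasShift C ℤ] [Preadditive C] [Linear k C]
    [∀ n : ℤ, (shiftFunctor C n).Additive]
    [Pretriangulated C] [IsTriangulated C]
    -- all Hom spaces are finite-dimensional
    (hHom : ∀ X Y : C, FiniteDimensional k (X ⟶ Y))
    -- indecomposable objects have local endomorphism rings
    (hLocal : ∀ X : C, Indecomposable X → IsLocalRing (End X))
    -- the shift functor is `t`-periodic for an odd `t > 1`
    (t : ℕ) (ht : Odd t) (ht1 : 1 < t)
    (hPer : Nonempty (shiftFunctor C (t : ℤ) ≅ 𝟭 C)) :
    -- the sum defining `u_[X] * u_[Y]` has finitely many nonzero terms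
    (∀ x y : PeriodicHall.IsoClasses C,
      {l : PeriodicHall.IsoClasses C | PeriodicHall.structConst k t x y l ≠ 0}.Finite) ∧
    -- the multiplication is associative
    (∀ a b c : PeriodicHall.HallSpace k C,
      PeriodicHall.hallMul k t C (PeriodicHall.hallMul k t C a b) c =
        PeriodicHall.hallMul k t C a (PeriodicHall.hallMul k t C b c)) ∧
    -- `u_[0]` is a two-sided unit
    (∀ a : PeriodicHall.HallSpace k C,
      PeriodicHall.hallMul k t C
          (PeriodicHall.basisVec k (PeriodicHall.isoClass (0 : C))) a = a ∧
        PeriodicHall.hallMul k t C a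
          (PeriodicHall.basisVec k (PeriodicHall.isoClass (0 : C))) = a) := by
  have hfin : ∀ X Y : C, Finite (X ⟶ Y) := fun X Y =>
    haveI := hHom X Y
    Module.finite_of_finite k
  obtain ⟨e⟩ := hPer
  exact ⟨fun x y => PeriodicHall.finite_structConst_ne_zero k t x y,
    PeriodicHall.hallMul_assoc k t ht e,
    fun a => ⟨PeriodicHall.hallMul_zero_left k t a, PeriodicHall.hallMul_zero_right k t a⟩⟩
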